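/- Let $\nu$ be a probability distribution on $\{0,1,2,\dots\}$ with finite mean $\mu$ and finite variance $\sigma^2$, and let $\eta>0$. The Gaussian channel with synchronization errors maps an input sequence $(x[1],\dots,x[T])\in\mathbb{R}^T$ to a random output sequence as follows. Draw i.i.d. states $s[1],\dots,s[T]$ with distribution $\nu$, let $L=\sum_{t=1}^T s[t]$, for $\ell\in\{1,\dots,L\}$ let $t[\ell]=\min\{t:\sum_{j=1}^t s[j]\ge \ell\}$ and $\tilde x[\ell]=x[t[\ell]]$ (so $s[t]$ is the number of times the symbol $x[t]$ is repeated), and let the output be $(y[1],\dots,y[L])$ with $y[\ell]=\tilde x[\ell]+z[\ell]$, where the $z[\ell]$ are i.i.d. $\mathcal{N}(0,\eta^2)$, independent of the states. The receiver observes $(y[1],\dots,y[L])$, in particular $L$, but not the states. A $(T,M,P,\varepsilon)$ code consists of $M$ codewords $(x_m[1],\dots,x_m[T])\in\mathbb{R}^T$, $m\in\{1,\dots,M\}$, each of energy $\sum_{t=1}^T x_m[t]^2\le P$ (with $P>0$), and a measurable decoder mapping each finite output sequence to a message or to a declared error, such that the average probability of decoding error over equiprobable messages is at most $\varepsilon$.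 The code may depend on $\nu$ and $\eta$. A rate $\hat R\ge 0$ per unit energy is achievable if for every $\varepsilon>0$ and every large enough $M$ there exist $T$ and $P$ and a $(T,M,P,\varepsilon)$ code with $\log_2(M)/P\ge\hat R$. The capacity per unit energy $\hat C(\mu,\sigma^2,\mathcal{N}(0,\eta^2))\in[0,\infty]$ is the supremum of the achievable rates per unit energy (and $0$ if there are none). Theorem. For every such $\nu$ and $\eta$, $$\hat C(\mu,\sigma^2,\mathcal{N}(0,\eta^2))=\frac{\mu}{2\eta^2\ln 2}.$$ -/

import Mathlib

open MeasureTheory ProbabilityTheory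
open scoped NNReal ENNReal

namespace SyncChannel

/-- The random output length of the insertion/deletion channel, as a function of its states:
input symbol number `t` appears `s t` times at the output. -/
def outLength {T : ℕ} (s : Fin T → ℕ) : ℕ := ∑ t, s t

/-- The time slots up to which more than `ℓ` output symbols have been produced. -/
def reached {T : ℕ} (s : Fin T → ℕ) (ℓ : ℕ) : Finset (Fin T) :=
  Finset.univ.filter fun t => ℓ < ∑ j ∈ Finset.Iic t, s j

theorem reached_nonempty {T : ℕ} (s : Fin T → ℕ) (ℓ : Fin (outLength s)) :
    (reached s ℓ).Nonempty := by
  cases T with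
  | zero =>
    have h := ℓ.isLt
    simp [outLength] at h
  | succ n =>
    refine ⟨Fin.last n, ?_⟩
    have h := ℓ.isLt
    have hu : Finset.Iic (Fin.last n) = Finset.univ := by
      ext j
      simp [Fin.le_last]
    unfold outLength at h
    simp only [reached, Finset.mem_filter, Finset.mem_univ, true_and, hu]
    exact h

/-- The index of the input symbol that is repeated as output symbol `ℓ`. Positions are counted
from `0` here, so that "at least `ℓ` symbols, counted from `1`" becomes "more than `ℓ`". -/
def samplingTime {T : ℕ} (s : Fin T → ℕ) (ℓ : Fin (outLength s)) : Fin T :=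
  (reached s ℓ).min' (reached_nonempty s ℓ)

/-- The output of the insertion/deletion channel with input `x` and states `s`. -/
def idcOutput {X : Type*} {T : ℕ} (x : Fin T → X) (s : Fin T → ℕ) : Fin (outLength s) → X :=
  fun ℓ => x (samplingTime s ℓ)

/-- Finite sequences over `Y` of arbitrary length: what the receiver sees. -/
abbrev Received (Y : Type*) : Type _ := Σ ℓ : ℕ, (Fin ℓ → Y)

/-- The law of the received sequence when `x` is sent: the states are i.i.d. with law `ν`, and,
given the states, each output symbol of the insertion/deletion channel is sent independently
through the memoryless channel `W`. -/
noncomputable def channelLaw {X Y : Type*} [MeasurableSpace Y] (ν : Measure ℕ)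
    (W : X → Measure Y) {T : ℕ} (x : Fin T → X) : Measure (Received Y) :=
  (Measure.pi fun _ : Fin T => ν).bind fun s =>
    (Measure.pi fun ℓ => W (idcOutput x s ℓ)).map fun y => ⟨outLength s, y⟩

/-- Encoder and decoder with `M` messages and block length `T`. The decoder sees the received
sequence, in particular its length, and outputs a message or (`none`) declares an error. -/
structure Code (X Y : Type*) [MeasurableSpace Y] (T M : ℕ) where
  /-- the codewords -/
  enc : Fin M → Fin T → X
  /-- the decoder -/
  dec : Received Y → Option (Fin M)
  /-- the decision regions are measurable -/
  measurableSet_dec : ∀ m, MeasurableSet {y | dec y = some m}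

/-- The average probability of decoding error, for equiprobable messages. -/
noncomputable def Code.avgError {X Y : Type*} [MeasurableSpace Y] {T M : ℕ}
    (C : Code X Y T M) (ν : Measure ℕ) (W : X → Measure Y) : ℝ≥0∞ :=
  (∑ m, channelLaw ν W (C.enc m) {y | C.dec y ≠ some m}) / (M : ℝ≥0∞)

/-- `C` is a `(T, M, P, ε)` code: each codeword has cost at most `P`, and the average probability
of error is at most `ε`. -/
def Code.IsGood {X Y : Type*} [MeasurableSpace Y] {T M : ℕ} (C : Code X Y T M)
    (ν : Measure ℕ) (W : X → Measure Y) (c : X → ℝ) (P ε : ℝ) : Prop :=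
  (∀ m, ∑ t, c (C.enc m t) ≤ P) ∧ C.avgError ν W ≤ ENNReal.ofReal ε

/-- Achievability of the rate `R` (in bits) per unit cost. -/
def IsAchievable {X Y : Type*} [MeasurableSpace Y] (ν : Measure ℕ) (W : X → Measure Y)
    (c : X → ℝ) (R : ℝ≥0) : Prop :=
  ∀ ε : ℝ, 0 < ε → ∃ M₀ : ℕ, ∀ M : ℕ, M₀ ≤ M →
    ∃ (T : ℕ) (P : ℝ) (C : Code X Y T M), 0 < P ∧ C.IsGood ν W c P ε ∧
      (R : ℝ) ≤ Real.logb 2 M / P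

/-- The capacity per unit cost: the supremum of the achievable rates per unit cost. -/
noncomputable def capacityPerUnitCost {X Y : Type*} [MeasurableSpace Y] (ν : Measure ℕ)
    (W : X → Measure Y) (c : X → ℝ) : ℝ≥0∞ :=
  ⨆ (R : ℝ≥0) (_ : IsAchievable ν W c R), (R : ℝ≥0∞)

/-- The additive Gaussian noise channel with noise variance `η ^ 2`. -/
noncomputable def gaussianChannel (η : ℝ) : ℝ → Measure ℝ :=
  fun x => gaussianReal x (Real.toNNReal (η ^ 2))

/-- The capacity per unit energy of the Gaussian channel with noise variance `η ^ 2` and with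
synchronization errors, where `ν` is the law of the number of copies of each input symbol. -/
noncomputable def gaussianSyncCapacity (ν : Measure ℕ) (η : ℝ) : ℝ≥0∞ :=
  capacityPerUnitCost ν (gaussianChannel η) fun x => x ^ 2

end SyncChannel

/-! Converse: fix the states `s`. The output is then Gaussian with independent coordinates and mean
`u`, and its divergence from the centered law is `∑ u² / (2η²)`. Its numerator is `∑ t, s t * x t ^
2` (`sum_idcOutput`). The centered law is the same for all messages, so the disjoint decision
regions have total mass at most `1` under it. The Gibbs inequality
`mul_measureReal_pi_gaussianReal_le`, with `c = log M`, then gives a Fano bound for each `s`. The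
divergence is linear in `s`, so averaging leaves only the mean `μ`: `(1 - ε) log M ≤ μP/(2η²) + 1`
(`Code.IsGood.log_le`).

Achievability: use pulse position modulation with `M` blocks of length `K`, at fixed pulse energy
`P`. As `K → ∞` with `M` and `P` fixed, block boundaries drift by order `√K`, while blocks occupy
about `Kμ` outputs. Fixed windows, slightly narrower than `Kμ`, therefore see only their own block
(`measureReal_exists_drift_le`). Thresholding the window sums has miss and false-alarm exponents
close to `δ²` and `(1 - δ)²` times `μP/(2η²)` (`measureReal_pulseCode_ne_le`). Below capacity the
latter can exceed `log M` by a factor above `1`, which pays for the union bound (`exists_back_off`).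
-/

namespace SyncChannel

/-! ### Change of measure between Gaussian product laws -/

section Gaussian

/-- The shifted law is the base measure because the divergence is an expectation under it. -/
theorem gaussianReal_zero_eq_withDensity (a : ℝ) {v : ℝ≥0} (hv : v ≠ 0) :
    gaussianReal 0 v = (gaussianReal a v).withDensity
      fun y => ENNReal.ofReal (Real.exp (-(a * y / v - a ^ 2 / (2 * v)))) := by
  rw [gaussianReal_of_var_ne_zero _ hv, gaussianReal_of_var_ne_zero _ hv,
    ← withDensity_mul _ (measurable_gaussianPDF _ _) (by fun_prop)]
  congr 1
  ext y
  have hv' : (v : ℝ) ≠ 0 := by exact_mod_cast hv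
  simp only [Pi.mul_apply, gaussianPDF]
  rw [← ENNReal.ofReal_mul (gaussianPDFReal_nonneg _ _ _)]
  congr 1
  simp only [gaussianPDFReal]
  rw [mul_assoc _ (Real.exp _), ← Real.exp_add]
  congr 2
  field_simp
  ring

/-- On a box, the integrand is a product of functions of separate coordinates, which are independent
under `Measure.pi μ`, so the integral factors. -/
theorem pi_withDensity {ι : Type*} [Fintype ι] {α : ι → Type*} [∀ i, MeasurableSpace (α i)]
    (μ : ∀ i, Measure (α i)) [∀ i, IsProbabilityMeasure (μ i)] {f : ∀ i, α i → ℝ≥0∞}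
    (hf : ∀ i, Measurable (f i)) [∀ i, SigmaFinite ((μ i).withDensity (f i))] :
    Measure.pi (fun i => (μ i).withDensity (f i)) =
      (Measure.pi μ).withDensity fun y => ∏ i, f i (y i) := by
  refine Measure.pi_eq fun s hs => ?_
  have hind : iIndepFun (fun i (y : ∀ i, α i) => (s i).indicator (f i) (y i)) (Measure.pi μ) :=
    iIndepFun_pi fun i => ((hf i).indicator (hs i)).aemeasurable
  have hprod := lintegral_prod_eq_prod_lintegral_of_indepFun Finset.univ _ hind
    fun i => ((hf i).indicator (hs i)).comp (measurable_pi_apply i)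
  rw [withDensity_apply _ (MeasurableSet.univ_pi hs), ← lintegral_indicator
    (MeasurableSet.univ_pi hs)]
  calc _ = ∫⁻ y, ∏ i, (s i).indicator (f i) (y i) ∂Measure.pi μ := by
        refine lintegral_congr fun y => ?_
        by_cases hy : y ∈ Set.univ.pi s
        · rw [Set.indicator_of_mem hy]
          exact Finset.prod_congr rfl fun i _ =>
            (Set.indicator_of_mem (hy i (Set.mem_univ i)) _).symm
        · rw [Set.indicator_of_notMem hy]
          simp only [Set.mem_pi, Set.mem_univ, true_implies, not_forall] at hy
          obtain ⟨i, hi⟩ := hy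
          exact (Finset.prod_eq_zero (Finset.mem_univ i) (Set.indicator_of_notMem hi _)).symm
    _ = _ := by
        rw [hprod]
        refine Finset.prod_congr rfl fun i _ => ?_
        rw [withDensity_apply _ (hs i), ← lintegral_indicator (hs i)]
        exact (measurePreserving_eval μ i).lintegral_comp ((hf i).indicator (hs i))

theorem pi_gaussianReal_zero_eq_withDensity {ι : Type*} [Fintype ι] (a : ι → ℝ) {v : ℝ≥0}
    (hv : v ≠ 0) :
    (Measure.pi fun _ : ι => gaussianReal 0 v) =
      (Measure.pi fun i => gaussianReal (a i) v).withDensity fun y =>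
        ENNReal.ofReal (Real.exp (-(∑ i, (a i * y i / v - a i ^ 2 / (2 * v))))) := by
  have h (i : ι) := gaussianReal_zero_eq_withDensity (a i) hv
  have (i : ι) : SigmaFinite ((gaussianReal (a i) v).withDensity
      fun y => ENNReal.ofReal (Real.exp (-(a i * y / v - a i ^ 2 / (2 * v))))) := by
    rw [← h i]; infer_instance
  have hpi := pi_withDensity (fun i => gaussianReal (a i) v)
    (f := fun i y => ENNReal.ofReal (Real.exp (-(a i * y / v - a i ^ 2 / (2 * v)))))
    (fun i => by fun_prop)
  simp only [← h] at hpi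
  rw [hpi]
  congr 1
  ext y
  rw [← ENNReal.ofReal_prod_of_nonneg fun i _ => (Real.exp_pos _).le, ← Real.exp_sum,
    Finset.sum_neg_distrib]

/-- A Gibbs inequality between a product of Gaussian measures and its centered version. -/
theorem mul_measureReal_pi_gaussianReal_le {ι : Type*} [Fintype ι] (a : ι → ℝ) {v : ℝ≥0}
    (hv : v ≠ 0) {D : Set (ι → ℝ)} (hD : MeasurableSet D) (c : ℝ) :
    c * (Measure.pi fun i => gaussianReal (a i) v).real D ≤
      (∑ i, a i ^ 2) / (2 * v) +
        Real.exp c * (Measure.pi fun _ : ι => gaussianReal 0 v).real D := by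
  set P := Measure.pi fun i => gaussianReal (a i) v with hP
  set Q := Measure.pi fun _ : ι => gaussianReal 0 v with hQ
  -- The log-likelihood ratio of `P` to `Q`; its `P`-mean is the divergence.
  set g : (ι → ℝ) → ℝ := fun y => ∑ i, (a i * y i / v - a i ^ 2 / (2 * v)) with hg
  have hv' : (v : ℝ) ≠ 0 := by exact_mod_cast hv
  have hgm : Measurable g := by fun_prop
  have hQP : Q = P.withDensity fun y => ENNReal.ofReal (Real.exp (-g y)) :=
    pi_gaussianReal_zero_eq_withDensity a hv
  have hexp : Integrable (fun y => Real.exp (-g y)) P := by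
    refine ⟨by fun_prop, ?_⟩
    rw [hasFiniteIntegral_iff_ofReal (.of_forall fun y => (Real.exp_pos _).le),
      ← setLIntegral_univ, ← withDensity_apply _ MeasurableSet.univ, ← hQP]
    exact measure_lt_top _ _
  have hreal {E : Set (ι → ℝ)} (hE : MeasurableSet E) :
      ∫ y in E, Real.exp (-g y) ∂P = Q.real E := by
    rw [Measure.real, hQP, withDensity_apply _ hE,
      integral_eq_lintegral_of_nonneg_ae (.of_forall fun y => (Real.exp_pos _).le) (by fun_prop)]
  have hid (i : ι) : Integrable (fun y : ι → ℝ => y i) P :=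
    integrable_comp_eval (μ := fun i => gaussianReal (a i) v) (f := fun y : ℝ => y)
      ((memLp_id_gaussianReal (μ := a i) (v := v) 1).integrable (by simp))
  have hterm (i : ι) : Integrable (fun y : ι → ℝ => a i * y i / v - a i ^ 2 / (2 * v)) P :=
    (((hid i).const_mul _).div_const _).sub (integrable_const _)
  have hgi : Integrable g P := integrable_finsetSum _ fun i _ => hterm i
  have hgint : ∫ y, g y ∂P = (∑ i, a i ^ 2) / (2 * v) := by
    rw [hg, integral_finsetSum _ fun i _ => hterm i, Finset.sum_div]
    refine Finset.sum_congr rfl fun i _ => ?_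
    rw [integral_sub (((hid i).const_mul _).div_const _) (integrable_const _),
      integral_div, integral_const_mul]
    have : ∫ y, y i ∂P = a i :=
      (integral_comp_eval (μ := fun i => gaussianReal (a i) v) (f := fun y : ℝ => y)
        (by fun_prop)).trans integral_id_gaussianReal
    rw [this]
    simp
    field_simp
    ring
  -- Use `x + 1 ≤ exp x` at `x = c - g` on `D` and at `x = -g` off `D`. After summation the total
  -- masses cancel, up to a term `-Q(D)` that is dropped.
  have hin : ∫ y in D, (c - g y) ∂P ≤ ∫ y in D, (Real.exp c * Real.exp (-g y) - 1) ∂P := by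
    refine integral_mono (((integrable_const c).sub hgi).integrableOn)
      (((hexp.const_mul _).sub (integrable_const 1)).integrableOn) fun y => ?_
    have := Real.add_one_le_exp (c + -g y)
    rw [Real.exp_add] at this
    simp only
    linarith
  have hout : ∫ y in Dᶜ, -g y ∂P ≤ ∫ y in Dᶜ, (Real.exp (-g y) - 1) ∂P := by
    refine integral_mono hgi.neg.integrableOn
      ((hexp.sub (integrable_const 1)).integrableOn) fun y => ?_
    have := Real.add_one_le_exp (-g y)
    simp only
    linarith
  rw [integral_sub (integrable_const c).integrableOn hgi.integrableOn,
    integral_sub (hexp.const_mul _).integrableOn (integrable_const 1).integrableOn,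
    integral_const_mul, hreal hD] at hin
  rw [integral_neg, integral_sub hexp.integrableOn (integrable_const 1).integrableOn,
    hreal hD.compl] at hout
  simp only [setIntegral_const, smul_eq_mul, mul_one] at hin hout
  have hsplit := integral_add_compl hD hgi
  have h1 := measureReal_add_measureReal_compl (μ := P) hD
  have h2 := measureReal_add_measureReal_compl (μ := Q) hD
  simp only [probReal_univ] at h1 h2
  have hq : 0 ≤ Q.real D := measureReal_nonneg
  rw [hgint] at hsplit
  linarith

end Gaussian

/-! ### Counting repetitions; the channel law as a mixture over states -/

section Channel

variable {T : ℕ}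

/-- The number of output symbols produced by the first `n` input symbols. -/
def partialLength (s : Fin T → ℕ) (n : ℕ) : ℕ :=
  ∑ j ∈ Finset.univ.filter (fun j : Fin T => (j : ℕ) < n), s j

/-- Partial sums are nondecreasing, so `reached s ℓ` is upward closed and its minimum determines it.
-/
theorem samplingTime_le_iff (s : Fin T → ℕ) (ℓ : Fin (outLength s)) (t : Fin T) :
    samplingTime s ℓ ≤ t ↔ (ℓ : ℕ) < ∑ j ∈ Finset.Iic t, s j := by
  constructor
  · intro h
    have hmem := Finset.min'_mem (reached s ℓ) (reached_nonempty s ℓ)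
    exact (Finset.mem_filter.1 hmem).2.trans_le
      (Finset.sum_le_sum_of_subset (Finset.Iic_subset_Iic.2 h))
  · intro h
    exact Finset.min'_le _ _ (Finset.mem_filter.2 ⟨Finset.mem_univ t, h⟩)

theorem samplingTime_lt_iff (s : Fin T → ℕ) (ℓ : Fin (outLength s)) (n : ℕ) (hn : n ≤ T) :
    (samplingTime s ℓ : ℕ) < n ↔ (ℓ : ℕ) < partialLength s n := by
  rcases n with _ | n
  · simp [partialLength]
  · have h := samplingTime_le_iff s ℓ ⟨n, hn⟩
    have he : Finset.Iic (⟨n, hn⟩ : Fin T) = Finset.univ.filter fun j : Fin T => (j : ℕ) < n + 1 := by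
      ext j
      simp [Fin.le_def]
    rw [he, Fin.le_def] at h
    rw [Nat.lt_succ_iff, partialLength]
    exact h

/-- The outputs sampled before slot `n` number `partialLength s n`; take the difference at `t + 1`
and `t`. -/
theorem card_samplingTime_eq (s : Fin T → ℕ) (t : Fin T) :
    (Finset.univ.filter fun ℓ => samplingTime s ℓ = t).card = s t := by
  have hcard (n : ℕ) (hn : n ≤ T) :
      (Finset.univ.filter fun ℓ => (samplingTime s ℓ : ℕ) < n).card =
        partialLength s n := by
    simp only [samplingTime_lt_iff s _ n hn]
    rw [Fin.card_filter_val_lt, min_eq_right]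
    exact Finset.sum_le_sum_of_subset (Finset.filter_subset _ _)
  have h1 := hcard t t.isLt.le
  have h2 := hcard (t + 1) t.isLt
  have e1 : (Finset.univ.filter fun ℓ => (samplingTime s ℓ : ℕ) < t + 1) =
      (Finset.univ.filter fun ℓ => samplingTime s ℓ = t) ∪
        (Finset.univ.filter fun ℓ => (samplingTime s ℓ : ℕ) < t) := by
    ext ℓ
    simp [Fin.ext_iff]
    omega
  have e2 : (Finset.univ.filter fun j : Fin T => (j : ℕ) < t + 1) =
      insert t (Finset.univ.filter fun j : Fin T => (j : ℕ) < t) := by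
    ext j
    simp [Fin.ext_iff]
    omega
  unfold partialLength at h1 h2
  rw [e1, Finset.card_union_of_disjoint, e2, Finset.sum_insert (by simp), h1] at h2
  · omega
  · rw [Finset.disjoint_filter]
    rintro ℓ - rfl
    simp

theorem sum_idcOutput {X : Type*} (x : Fin T → X) (s : Fin T → ℕ) (f : X → ℝ) :
    ∑ ℓ, f (idcOutput x s ℓ) = ∑ t, s t * f (x t) := by
  unfold idcOutput
  rw [← Finset.sum_fiberwise (g := samplingTime s)]
  refine Finset.sum_congr rfl fun t _ => ?_
  rw [Finset.sum_congr rfl (g := fun _ => f (x t)), Finset.sum_const, card_samplingTime_eq,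
    nsmul_eq_mul]
  intro ℓ hℓ
  rw [(Finset.mem_filter.1 hℓ).2]

variable {X Y : Type*} [MeasurableSpace Y]

theorem measurable_received_mk (n : ℕ) : Measurable fun y : Fin n → Y => (⟨n, y⟩ : Received Y) := by
  intro A hA
  exact MeasurableSpace.measurableSet_iInf.1 hA n

theorem channelLaw_apply (ν : Measure ℕ) (W : X → Measure Y) (x : Fin T → X)
    {A : Set (Received Y)} (hA : MeasurableSet A) :
    channelLaw ν W x A = ∫⁻ s, Measure.pi (fun ℓ => W (idcOutput x s ℓ)) {y | (⟨_, y⟩ : Received Y) ∈ A}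
      ∂Measure.pi fun _ : Fin T => ν := by
  rw [channelLaw, Measure.bind_apply hA (Measurable.of_discrete).aemeasurable]
  exact lintegral_congr fun s => Measure.map_apply (measurable_received_mk _) hA

instance isProbabilityMeasure_channelLaw (ν : Measure ℕ) [IsProbabilityMeasure ν]
    (W : X → Measure Y) [∀ x, IsProbabilityMeasure (W x)] (x : Fin T → X) :
    IsProbabilityMeasure (channelLaw ν W x) :=
  ⟨by rw [channelLaw_apply ν W x MeasurableSet.univ]; simp⟩

theorem channelLaw_real_apply (ν : Measure ℕ) [IsProbabilityMeasure ν]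
    (W : X → Measure Y) [∀ x, IsProbabilityMeasure (W x)] (x : Fin T → X)
    {A : Set (Received Y)} (hA : MeasurableSet A) :
    (channelLaw ν W x).real A =
      ∫ s, (Measure.pi fun ℓ => W (idcOutput x s ℓ)).real {y | (⟨_, y⟩ : Received Y) ∈ A}
        ∂Measure.pi fun _ : Fin T => ν := by
  rw [Measure.real, channelLaw_apply ν W x hA, integral_eq_lintegral_of_nonneg_ae
    (.of_forall fun s => measureReal_nonneg) (Measurable.of_discrete).aestronglyMeasurable]
  congr 1
  exact lintegral_congr fun s => (ofReal_measureReal (measure_ne_top _ _)).symm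

end Channel

/-! ### Converse -/

section Converse

instance isProbabilityMeasure_gaussianChannel (η x : ℝ) :
    IsProbabilityMeasure (gaussianChannel η x) := by
  unfold gaussianChannel
  infer_instance

variable {T M : ℕ}

theorem integrable_state {ν : Measure ℕ} [IsProbabilityMeasure ν]
    (hν : Integrable (fun n : ℕ => (n : ℝ)) ν) (t : Fin T) :
    Integrable (fun s : Fin T → ℕ => (s t : ℝ)) (Measure.pi fun _ => ν) :=
  integrable_comp_eval (μ := fun _ : Fin T => ν) (f := fun n : ℕ => (n : ℝ)) hν

theorem integral_state {ν : Measure ℕ} [IsProbabilityMeasure ν] (t : Fin T) :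
    ∫ s : Fin T → ℕ, (s t : ℝ) ∂Measure.pi (fun _ => ν) = ∫ n : ℕ, (n : ℝ) ∂ν :=
  integral_comp_eval (μ := fun _ : Fin T => ν) (f := fun n : ℕ => (n : ℝ))
    (Measurable.of_discrete).aestronglyMeasurable

theorem Code.sum_measureReal_dec_le_one {X Y : Type*} [MeasurableSpace Y] (C : Code X Y T M)
    {Ω : Type*} [MeasurableSpace Ω] (Q : Measure Ω) [IsProbabilityMeasure Q] {f : Ω → Received Y}
    (hf : Measurable f) : ∑ m, Q.real {y | C.dec (f y) = some m} ≤ 1 := by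
  rw [← measureReal_biUnion_finset]
  · exact measureReal_le_one
  · intro i _ j _ hij
    refine Set.disjoint_left.2 fun y hy hy' => hij ?_
    exact Option.some.inj (hy.symm.trans hy')
  · exact fun m _ => hf (C.measurableSet_dec m)

/-- The Gibbs inequality summed over messages: `c = log M` turns `exp c` into `M`, multiplying a
total reference mass of at most `1`. -/
theorem Code.sum_log_mul_le (C : Code ℝ ℝ T M) (hM : 0 < M) {η : ℝ} (hη : 0 < η)
    (s : Fin T → ℕ) :
    ∑ m, Real.log M * (Measure.pi fun ℓ => gaussianChannel η (idcOutput (C.enc m) s ℓ)).real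
        {y | C.dec ⟨_, y⟩ = some m} ≤
      ∑ m, (∑ t, s t * C.enc m t ^ 2) / (2 * η ^ 2) + M := by
  have hη2 : 0 < η ^ 2 := by positivity
  have hv : Real.toNNReal (η ^ 2) ≠ 0 := by simpa using hη2.not_ge
  have hterm (m : Fin M) := mul_measureReal_pi_gaussianReal_le (idcOutput (C.enc m) s) hv
    (measurable_received_mk (outLength s) (C.measurableSet_dec m)) (Real.log M)
  have hsum := Finset.sum_le_sum fun m (_ : m ∈ Finset.univ) => hterm m
  rw [Finset.sum_add_distrib, Real.exp_log (by exact_mod_cast hM)] at hsum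
  refine hsum.trans (add_le_add (le_of_eq ?_) ?_)
  swap
  · rw [← Finset.mul_sum]
    exact mul_le_of_le_one_right (Nat.cast_nonneg M)
      (C.sum_measureReal_dec_le_one _ (measurable_received_mk _))
  refine Finset.sum_congr rfl fun m _ => ?_
  rw [Real.coe_toNNReal _ hη2.le, ← sum_idcOutput (C.enc m) s fun x => x ^ 2]

theorem Code.sum_channelLaw_ge {X Y : Type*} [MeasurableSpace Y] (C : Code X Y T M) (hM : 0 < M)
    {ν : Measure ℕ} [IsProbabilityMeasure ν] {W : X → Measure Y} [∀ x, IsProbabilityMeasure (W x)]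
    {ε : ℝ} (hε : 0 ≤ ε) (h : C.avgError ν W ≤ ENNReal.ofReal ε) :
    (1 - ε) * M ≤ ∑ m, (channelLaw ν W (C.enc m)).real {y | C.dec y = some m} := by
  have hM' : (M : ℝ≥0∞) ≠ 0 := by exact_mod_cast hM.ne'
  rw [Code.avgError, ENNReal.div_le_iff hM' (ENNReal.natCast_ne_top M)] at h
  have h' := ENNReal.toReal_mono (ENNReal.mul_ne_top ENNReal.ofReal_ne_top
    (ENNReal.natCast_ne_top M)) h
  rw [ENNReal.toReal_sum fun m _ => measure_ne_top _ _, ENNReal.toReal_mul,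
    ENNReal.toReal_ofReal hε, ENNReal.toReal_natCast] at h'
  have hc (m : Fin M) : (channelLaw ν W (C.enc m) {y | C.dec y ≠ some m}).toReal =
      1 - (channelLaw ν W (C.enc m)).real {y | C.dec y = some m} :=
    probReal_compl_eq_one_sub (C.measurableSet_dec m)
  simp only [hc, Finset.sum_sub_distrib, Finset.sum_const, Finset.card_univ, Fintype.card_fin,
    nsmul_eq_mul, mul_one] at h'
  linarith

/-- The Fano-type bound on the size of a code in terms of its energy. -/
theorem Code.IsGood.log_le {C : Code ℝ ℝ T M} (hM : 0 < M) {ν : Measure ℕ}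
    [IsProbabilityMeasure ν] (hν : Integrable (fun n : ℕ => (n : ℝ)) ν) {η : ℝ} (hη : 0 < η)
    {P ε : ℝ} (hε : 0 ≤ ε) (h : C.IsGood ν (gaussianChannel η) (fun x => x ^ 2) P ε) :
    (1 - ε) * Real.log M ≤ (∫ n : ℕ, (n : ℝ) ∂ν) * P / (2 * η ^ 2) + 1 := by
  have hint : Integrable (fun s : Fin T → ℕ => ∑ m, (∑ t, s t * C.enc m t ^ 2) / (2 * η ^ 2))
      (Measure.pi fun _ => ν) :=
    integrable_finsetSum _ fun m _ => (integrable_finsetSum _ fun t _ =>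
      (integrable_state hν t).mul_const _).div_const _
  have hG (m : Fin M) : Integrable (fun s : Fin T → ℕ =>
      (Measure.pi fun ℓ => gaussianChannel η (idcOutput (C.enc m) s ℓ)).real
        {y | C.dec ⟨_, y⟩ = some m}) (Measure.pi fun _ => ν) := by
    refine Integrable.of_bound (Measurable.of_discrete).aestronglyMeasurable 1
      (.of_forall fun s => ?_)
    rw [Real.norm_of_nonneg measureReal_nonneg]
    exact measureReal_le_one
  have hmono := integral_mono (integrable_finsetSum Finset.univ fun m _ => (hG m).const_mul _)
    (hint.add (integrable_const (M : ℝ))) fun s => C.sum_log_mul_le hM hη s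
  simp only [Pi.add_apply] at hmono
  rw [integral_finsetSum _ fun m _ => (hG m).const_mul _, integral_add hint (integrable_const _),
    integral_finsetSum _ fun m _ => (integrable_finsetSum _ fun t _ =>
      (integrable_state hν t).mul_const _).div_const _] at hmono
  simp only [integral_const_mul, integral_div, integral_const, probReal_univ, one_smul] at hmono
  have hlaw (m : Fin M) := channelLaw_real_apply ν (gaussianChannel η) (C.enc m)
    (C.measurableSet_dec m)
  simp only [Set.mem_ofPred_eq] at hlaw
  simp only [← hlaw, ← Finset.mul_sum] at hmono
  have hcost (m : Fin M) : ∫ s : Fin T → ℕ, ∑ t, s t * C.enc m t ^ 2 ∂Measure.pi (fun _ => ν) ≤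
      (∫ n : ℕ, (n : ℝ) ∂ν) * P := by
    rw [integral_finsetSum _ fun t _ => (integrable_state hν t).mul_const _]
    simp only [integral_mul_const, integral_state, ← Finset.mul_sum]
    exact mul_le_mul_of_nonneg_left (h.1 m) (integral_nonneg fun n => Nat.cast_nonneg n)
  have hsucc := C.sum_channelLaw_ge hM hε h.2
  have hlog : 0 ≤ Real.log M := Real.log_natCast_nonneg M
  have hMpos : (0 : ℝ) < M := by exact_mod_cast hM
  have hcosts : ∑ m : Fin M, (∫ s : Fin T → ℕ, ∑ t, s t * C.enc m t ^ 2
      ∂Measure.pi (fun _ => ν)) / (2 * η ^ 2) ≤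
      M * ((∫ n : ℕ, (n : ℝ) ∂ν) * P / (2 * η ^ 2)) := by
    refine (Finset.sum_le_sum (g := fun _ => (∫ n : ℕ, (n : ℝ) ∂ν) * P / (2 * η ^ 2))
      fun m _ => div_le_div_of_nonneg_right (hcost m) (by positivity)).trans (le_of_eq ?_)
    simp
  have := mul_le_mul_of_nonneg_left hsucc hlog
  refine le_of_mul_le_mul_left ?_ hMpos
  linarith

theorem IsAchievable.le {ν : Measure ℕ} [IsProbabilityMeasure ν]
    (hν : Integrable (fun n : ℕ => (n : ℝ)) ν) {η : ℝ} (hη : 0 < η) {R : ℝ≥0}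
    (h : IsAchievable ν (gaussianChannel η) (fun x => x ^ 2) R) :
    (R : ℝ) ≤ (∫ n : ℕ, (n : ℝ) ∂ν) / (2 * η ^ 2 * Real.log 2) := by
  set μ := ∫ n : ℕ, (n : ℝ) ∂ν with hμ
  have hμ0 : 0 ≤ μ := integral_nonneg fun n => Nat.cast_nonneg n
  have hlog2 : 0 < Real.log 2 := Real.log_pos one_lt_two
  rcases R.coe_nonneg.eq_or_lt with hR | hR
  · rw [← hR]
    positivity
  refine le_of_forall_pos_le_add fun δ hδ => ?_
  -- Half of the slack `δ` pays for the factor `1 - ε`; the other half pays for the additive `1`,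
  -- once `log M ≥ 2R/δ`.
  set ε : ℝ := min (δ / (2 * R)) 1 with hεdef
  have hε : 0 < ε := lt_min (by positivity) one_pos
  have hεR : ε * R ≤ δ / 2 := by
    have := mul_le_mul_of_nonneg_right (min_le_left (δ / (2 * R)) 1) hR.le
    refine this.trans (le_of_eq ?_)
    field_simp
  obtain ⟨M₀, hM₀⟩ := h ε hε
  have hlim : Filter.Tendsto (fun n : ℕ => Real.log n) Filter.atTop Filter.atTop :=
    Real.tendsto_log_atTop.comp tendsto_natCast_atTop_atTop
  obtain ⟨M, hMM₀, hM1, hMlog⟩ := ((Filter.eventually_ge_atTop M₀).and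
    ((Filter.eventually_gt_atTop 0).and (hlim.eventually_ge_atTop (max 1 (2 * R / δ))))).exists
  obtain ⟨T, P, C, hP, hgood, hRP⟩ := hM₀ M hMM₀
  have hlogM : 0 < Real.log M := lt_of_lt_of_le one_pos ((le_max_left _ _).trans hMlog)
  have hb := hgood.log_le hM1 hν hη hε.le
  rw [← hμ] at hb
  have hRP' : R * P * Real.log 2 ≤ Real.log M := by
    rw [le_div_iff₀ hP, Real.logb, le_div_iff₀ hlog2] at hRP
    exact hRP
  have hRM : R ≤ δ / 2 * Real.log M := by
    have := (le_max_right _ _).trans hMlog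
    rw [div_le_iff₀ hδ] at this
    linarith
  refine le_of_mul_le_mul_left ?_ hlogM
  have h1 := mul_le_mul_of_nonneg_left hb hR.le
  have h2 : R * (μ * P / (2 * η ^ 2)) ≤ Real.log M * (μ / (2 * η ^ 2 * Real.log 2)) := by
    calc R * (μ * P / (2 * η ^ 2)) = R * P * Real.log 2 * (μ / (2 * η ^ 2 * Real.log 2)) := by
          field_simp
      _ ≤ _ := mul_le_mul_of_nonneg_right hRP' (by positivity)
  have h3 := mul_le_mul_of_nonneg_right hεR hlogM.le
  nlinarith

end Converse

/-! ### Sub-Gaussian tails of window sums -/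

section Tails

theorem hasSubgaussianMGF_gaussianReal_sub (a : ℝ) (v : ℝ≥0) :
    HasSubgaussianMGF (fun y => y - a) v (gaussianReal a v) := by
  have h : (gaussianReal a v).map (fun y => y - a) = gaussianReal 0 v := by
    rw [gaussianReal_map_sub_const, sub_self]
  refine (HasSubgaussianMGF.id_map_iff (by fun_prop)).1 ?_
  rw [h]
  refine ⟨fun t => integrable_exp_mul_gaussianReal t, fun t => ?_⟩
  rw [mgf_id_gaussianReal]
  simp

variable {ι : Type*} [Fintype ι] (a : ι → ℝ) (v : ℝ≥0) (S : Finset ι) {t : ℝ}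

theorem measureReal_pi_gaussianReal_ge_le (ht : 0 ≤ t) :
    (Measure.pi fun i => gaussianReal (a i) v).real {y | t ≤ ∑ i ∈ S, (y i - a i)} ≤
      Real.exp (-t ^ 2 / (2 * (S.card * v))) := by
  have hind : iIndepFun (fun i (y : ι → ℝ) => y i - a i)
      (Measure.pi fun i => gaussianReal (a i) v) :=
    iIndepFun_pi (X := fun i (y : ℝ) => y - a i) fun i => by fun_prop
  have hsub (i : ι) : HasSubgaussianMGF (fun y : ι → ℝ => y i - a i) v
      (Measure.pi fun i => gaussianReal (a i) v) := by
    refine HasSubgaussianMGF.of_map (X := fun y : ℝ => y - a i) (Y := fun y : ι → ℝ => y i)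
      (measurable_pi_apply i).aemeasurable ?_
    rw [show Measure.map (fun y : ι → ℝ => y i) _ = _ from
      (measurePreserving_eval (fun i => gaussianReal (a i) v) i).map_eq]
    exact hasSubgaussianMGF_gaussianReal_sub _ _
  simpa using HasSubgaussianMGF.measure_sum_ge_le_of_iIndepFun hind (s := S) (fun i _ => hsub i) ht

theorem measureReal_pi_gaussianReal_le_le (ht : 0 ≤ t) :
    (Measure.pi fun i => gaussianReal (a i) v).real {y | ∑ i ∈ S, (y i - a i) ≤ -t} ≤
      Real.exp (-t ^ 2 / (2 * (S.card * v))) := by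
  have hind : iIndepFun (fun i (y : ι → ℝ) => -(y i - a i))
      (Measure.pi fun i => gaussianReal (a i) v) :=
    iIndepFun_pi (X := fun i (y : ℝ) => -(y - a i)) fun i => by fun_prop
  have hsub (i : ι) : HasSubgaussianMGF (fun y : ι → ℝ => -(y i - a i)) v
      (Measure.pi fun i => gaussianReal (a i) v) := by
    refine HasSubgaussianMGF.of_map (X := fun y : ℝ => -(y - a i)) (Y := fun y : ι → ℝ => y i)
      (measurable_pi_apply i).aemeasurable ?_
    rw [show Measure.map (fun y : ι → ℝ => y i) _ = _ from
      (measurePreserving_eval (fun i => gaussianReal (a i) v) i).map_eq]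
    exact (hasSubgaussianMGF_gaussianReal_sub _ _).neg
  have := HasSubgaussianMGF.measure_sum_ge_le_of_iIndepFun hind (s := S) (fun i _ => hsub i) ht
  simp only [Finset.sum_neg_distrib, le_neg (a := t)] at this
  simpa using this

end Tails

/-! ### Chebyshev bound on the drift -/

section Drift

theorem partialLength_le_outLength {T : ℕ} (s : Fin T → ℕ) (n : ℕ) :
    partialLength s n ≤ outLength s :=
  Finset.sum_le_sum_of_subset (Finset.filter_subset _ _)

variable {ν : Measure ℕ} [IsProbabilityMeasure ν]

theorem measureReal_partialLength_le (hν : MemLp (fun n : ℕ => (n : ℝ)) 2 ν) {T n : ℕ}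
    (hn : n ≤ T) {d : ℝ} (hd : 0 < d) :
    (Measure.pi fun _ : Fin T => ν).real
        {s | d ≤ |(partialLength s n : ℝ) - n * ∫ k : ℕ, (k : ℝ) ∂ν|} ≤
      T * variance (fun k : ℕ => (k : ℝ)) ν / d ^ 2 := by
  -- Zeroing the later coordinates writes every partial length as a sum over all of `Fin T`, with a
  -- variance bound uniform in `n`.
  set X : Fin T → ℕ → ℝ := fun i k => if (i : ℕ) < n then (k : ℝ) else 0 with hX
  have hmem (i : Fin T) : MemLp (X i) 2 ν := by
    by_cases hi : (i : ℕ) < n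
    · simpa [hX, hi] using hν
    · simp [hX, hi]
  have hpl (s : Fin T → ℕ) : (partialLength s n : ℝ) = ∑ i, X i (s i) := by
    simp [partialLength, hX, Finset.sum_filter]
  have hvar : Var[∑ i, fun s : Fin T → ℕ => X i (s i); Measure.pi fun _ => ν] ≤
      T * variance (fun k : ℕ => (k : ℝ)) ν := by
    rw [variance_sum_pi hmem]
    calc _ ≤ ∑ _i : Fin T, variance (fun k : ℕ => (k : ℝ)) ν := by
          refine Finset.sum_le_sum fun i _ => ?_
          by_cases hi : (i : ℕ) < n
          · simp [hX, hi]
          · simp only [hX, hi, if_false]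
            rw [show (fun _ : ℕ => (0 : ℝ)) = 0 from rfl, variance_zero]
            exact variance_nonneg _ _
      _ = _ := by simp
  have hmem' (i : Fin T) : MemLp (fun s : Fin T → ℕ => X i (s i)) 2 (Measure.pi fun _ => ν) :=
    (hmem i).comp_measurePreserving (measurePreserving_eval (fun _ => ν) i)
  have hmean : ∫ s, (∑ i, fun s : Fin T → ℕ => X i (s i)) s ∂Measure.pi (fun _ => ν) =
      n * ∫ k : ℕ, (k : ℝ) ∂ν := by
    simp only [Finset.sum_apply]
    rw [integral_finsetSum _ fun i _ => (hmem' i).integrable one_le_two]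
    have (i : Fin T) : ∫ s : Fin T → ℕ, X i (s i) ∂Measure.pi (fun _ => ν) =
        if (i : ℕ) < n then ∫ k : ℕ, (k : ℝ) ∂ν else 0 := by
      rw [integral_comp_eval (μ := fun _ : Fin T => ν) (f := X i)
        (Measurable.of_discrete).aestronglyMeasurable]
      by_cases hi : (i : ℕ) < n <;> simp [hX, hi]
    simp only [this]
    rw [← Finset.sum_filter, Finset.sum_const, Fin.card_filter_val_lt, min_eq_right hn,
      nsmul_eq_mul]
  have hcheb := meas_ge_le_variance_div_sq (memLp_finsetSum' Finset.univ fun i _ => hmem' i) hd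
  rw [hmean] at hcheb
  simp only [Finset.sum_apply, ← hpl] at hcheb
  refine (ENNReal.toReal_mono ENNReal.ofReal_ne_top hcheb).trans ?_
  rw [ENNReal.toReal_ofReal (div_nonneg (variance_nonneg _ _) (sq_nonneg d))]
  exact div_le_div_of_nonneg_right hvar (sq_nonneg d)

end Drift

/-! ### Pulse position modulation and its threshold decoder -/

section PulsePosition

/-- Pulse position modulation: message `m` is sent as a pulse of amplitude `A` that fills the
`m`-th block of length `K`. -/
def pulse (M K : ℕ) (A : ℝ) (m : Fin M) (j : Fin (M * K)) : ℝ :=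
  if (m : ℕ) * K ≤ j ∧ (j : ℕ) < (m + 1) * K then A else 0

/-- The positions of a window of length `w` that starts at `a`, among the first `n` ones. -/
def window (n a w : ℕ) : Finset (Fin n) :=
  Finset.univ.filter fun ℓ => a ≤ (ℓ : ℕ) ∧ (ℓ : ℕ) < a + w

theorem card_window {n a w : ℕ} (h : a + w ≤ n) : (window n a w).card = w := by
  have : (window n a w).map Fin.valEmbedding = Finset.Ico a (a + w) := by
    ext i
    simp only [window, Finset.mem_map, Finset.mem_filter, Finset.mem_univ, true_and,
      Fin.valEmbedding_apply, Finset.mem_Ico]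
    exact ⟨by rintro ⟨ℓ, hℓ, rfl⟩; exact hℓ, fun hi => ⟨⟨i, by omega⟩, hi, rfl⟩⟩
  rw [← Finset.card_map Fin.valEmbedding, this, Nat.card_Ico, Nat.add_sub_cancel_left]

theorem sum_pulse_sq {M K : ℕ} (A : ℝ) (m : Fin M) : ∑ j, pulse M K A m j ^ 2 = K * A ^ 2 := by
  have h : (m : ℕ) * K + K ≤ M * K := by
    rw [← Nat.succ_mul]
    exact Nat.mul_le_mul_right K m.isLt
  have := card_window h
  simp only [pulse, ite_pow, ne_eq, OfNat.ofNat_ne_zero, not_false_eq_true, zero_pow]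
  rw [← Finset.sum_filter, Finset.sum_const, nsmul_eq_mul]
  simp only [window] at this
  simp only [add_mul, one_mul, this]

/-- The correlation of the received sequence with a window. -/
def correlation (a w : ℕ) (y : Received ℝ) : ℝ := ∑ ℓ ∈ window y.1 a w, y.2 ℓ

theorem measurable_correlation (a w : ℕ) : Measurable (correlation a w) := by
  intro B hB
  refine MeasurableSpace.measurableSet_iInf.2 fun n => ?_
  have : Measurable fun y : Fin n → ℝ => ∑ ℓ ∈ window n a w, y ℓ := by fun_prop
  exact this hB

open scoped Classical in
/-- The decoder that looks for a unique window whose correlation exceeds the threshold `τ`. -/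
noncomputable def thresholdDecoder {M : ℕ} (a : Fin M → ℕ) (w : ℕ) (τ : ℝ) (y : Received ℝ) :
    Option (Fin M) :=
  if h : ∃! m, τ ≤ correlation (a m) w y then some h.choose else none

theorem thresholdDecoder_eq_some_iff {M : ℕ} (a : Fin M → ℕ) (w : ℕ) (τ : ℝ) (y : Received ℝ)
    (m : Fin M) : thresholdDecoder a w τ y = some m ↔
      τ ≤ correlation (a m) w y ∧ ∀ m', m' ≠ m → correlation (a m') w y < τ := by
  unfold thresholdDecoder
  constructor
  · intro hm
    split_ifs at hm with h
    obtain rfl := Option.some.inj hm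
    refine ⟨h.choose_spec.1, fun m' hm' => ?_⟩
    by_contra! hc
    exact hm' (h.choose_spec.2 m' hc)
  · rintro ⟨h1, h2⟩
    have h : ∃! m, τ ≤ correlation (a m) w y := by
      refine ⟨m, h1, fun m' hm' => ?_⟩
      by_contra hne
      exact (h2 m' hne).not_ge hm'
    rw [dif_pos h, h.unique h.choose_spec.1 h1]

/-- Pulse position modulation with the threshold decoder. -/
noncomputable def pulseCode (M K : ℕ) (A : ℝ) (a : Fin M → ℕ) (w : ℕ) (τ : ℝ) :
    Code ℝ ℝ (M * K) M where
  enc := pulse M K A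
  dec := thresholdDecoder a w τ
  measurableSet_dec m := by
    have h : {y | thresholdDecoder a w τ y = some m} = {y | τ ≤ correlation (a m) w y} ∩
        ⋂ m', ⋂ _ : m' ≠ m, {y | correlation (a m') w y < τ} := by
      ext
      simp [thresholdDecoder_eq_some_iff]
    rw [h]
    refine (measurableSet_le measurable_const (measurable_correlation _ _)).inter ?_
    exact .iInter fun m' => .iInter fun _ =>
      measurableSet_lt (measurable_correlation _ _) measurable_const

/-- The error probability given states for which each window receives copies of its own block
only. -/
theorem measureReal_pulseCode_ne_le {M K w : ℕ} {A η δ : ℝ} (hA : 0 ≤ A) (hη : 0 < η)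
    (hδ : 0 ≤ δ) (hδ1 : δ ≤ 1) (hw : 0 < w) (a : Fin M → ℕ) {s : Fin (M * K) → ℕ}
    (hs : ∀ m : Fin M, partialLength s (m * K) ≤ a m ∧
      a m + w ≤ partialLength s ((m + 1) * K)) (m : Fin M) :
    (Measure.pi fun ℓ => gaussianChannel η (idcOutput (pulse M K A m) s ℓ)).real
        {y | (pulseCode M K A a w ((1 - δ) * (w * A))).dec ⟨_, y⟩ ≠ some m} ≤
      Real.exp (-(δ ^ 2 * (w * A ^ 2) / (2 * η ^ 2))) +
        M * Real.exp (-((1 - δ) ^ 2 * (w * A ^ 2) / (2 * η ^ 2))) := by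
  set u := idcOutput (pulse M K A m) s with hu
  set v := Real.toNNReal (η ^ 2) with hv
  have hv' : (v : ℝ) = η ^ 2 := Real.coe_toNNReal _ (by positivity)
  have hw' : (0 : ℝ) < w := by exact_mod_cast hw
  have hcard (m' : Fin M) : (window (outLength s) (a m') w).card = w :=
    card_window ((hs m').2.trans (partialLength_le_outLength _ _))
  have hblock (m' : Fin M) {ℓ : Fin (outLength s)} (hℓ : ℓ ∈ window (outLength s) (a m') w) :
      (m' : ℕ) * K ≤ samplingTime s ℓ ∧ (samplingTime s ℓ : ℕ) < (m' + 1) * K := by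
    have hℓ' := (Finset.mem_filter.1 hℓ).2
    have hle : ((m' : ℕ) + 1) * K ≤ M * K := Nat.mul_le_mul_right K m'.isLt
    have hle' : (m' : ℕ) * K ≤ M * K := Nat.mul_le_mul_right K m'.isLt.le
    constructor
    · by_contra! hc
      rw [samplingTime_lt_iff s ℓ _ hle'] at hc
      have := (hs m').1
      omega
    · rw [samplingTime_lt_iff s ℓ _ hle]
      have := (hs m').2
      omega
  have hself {ℓ : Fin (outLength s)} (hℓ : ℓ ∈ window (outLength s) (a m) w) : u ℓ = A :=
    if_pos (hblock m hℓ)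
  have hother {m' : Fin M} (hm' : m' ≠ m) {ℓ : Fin (outLength s)}
      (hℓ : ℓ ∈ window (outLength s) (a m') w) : u ℓ = 0 := by
    refine if_neg fun h => hm' ?_
    have h' := hblock m' hℓ
    have h1 : (m : ℕ) < m' + 1 := lt_of_mul_lt_mul_right (h.1.trans_lt h'.2) (Nat.zero_le K)
    have h2 : (m' : ℕ) < m + 1 := lt_of_mul_lt_mul_right (h'.1.trans_lt h.2) (Nat.zero_le K)
    exact Fin.ext (by omega)
  -- The correct window sum has mean `wA`, the others mean `0`; the threshold `(1 - δ)wA` lies `δwA`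
  -- below the former.
  have hmiss : (Measure.pi fun ℓ => gaussianReal (u ℓ) v).real
      {y | ∑ ℓ ∈ window (outLength s) (a m) w, (y ℓ - u ℓ) ≤ -(δ * (w * A))} ≤
      Real.exp (-(δ ^ 2 * (w * A ^ 2) / (2 * η ^ 2))) := by
    refine (measureReal_pi_gaussianReal_le_le u v _ (by positivity)).trans_eq ?_
    rw [hcard, hv']
    congr 1
    field_simp
  have hfalse (m' : Fin M) : (Measure.pi fun ℓ => gaussianReal (u ℓ) v).real
      {y | (1 - δ) * (w * A) ≤ ∑ ℓ ∈ window (outLength s) (a m') w, (y ℓ - u ℓ)} ≤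
      Real.exp (-((1 - δ) ^ 2 * (w * A ^ 2) / (2 * η ^ 2))) := by
    refine (measureReal_pi_gaussianReal_ge_le u v _
      (mul_nonneg (by linarith) (by positivity))).trans_eq ?_
    rw [hcard, hv']
    congr 1
    field_simp
  -- The union also includes `m' = m`, which costs only a factor `M` instead of `M - 1`.
  have hsub : {y : Fin (outLength s) → ℝ |
      (pulseCode M K A a w ((1 - δ) * (w * A))).dec ⟨_, y⟩ ≠ some m} ⊆
      {y | ∑ ℓ ∈ window (outLength s) (a m) w, (y ℓ - u ℓ) ≤ -(δ * (w * A))} ∪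
        ⋃ m' ∈ (Finset.univ : Finset (Fin M)),
          {y | (1 - δ) * (w * A) ≤ ∑ ℓ ∈ window (outLength s) (a m') w, (y ℓ - u ℓ)} := by
    intro y hy
    by_contra hc
    simp only [Set.mem_union, Set.mem_iUnion, Finset.mem_univ, exists_prop, true_and,
      Set.mem_ofPred_eq, not_or, not_exists, not_le] at hc
    refine hy ((thresholdDecoder_eq_some_iff _ _ _ _ _).2 ⟨?_, fun m' hm' => ?_⟩)
    · have h1 := hc.1
      rw [Finset.sum_sub_distrib, Finset.sum_congr rfl fun ℓ hℓ => hself hℓ, Finset.sum_const,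
        hcard, nsmul_eq_mul] at h1
      change (1 - δ) * (w * A) ≤ ∑ ℓ ∈ window (outLength s) (a m) w, y ℓ
      linarith
    · have h1 := hc.2 m'
      rw [Finset.sum_sub_distrib, Finset.sum_congr rfl fun ℓ hℓ => hother hm' hℓ,
        Finset.sum_const_zero, sub_zero] at h1
      exact h1
  refine (measureReal_mono hsub).trans ((measureReal_union_le _ _).trans (add_le_add hmiss ?_))
  refine (measureReal_biUnion_finset_le _ _).trans
    ((Finset.sum_le_sum fun m' _ => hfalse m').trans_eq ?_)
  simp

end PulsePosition

/-! ### Achievability -/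

section Achievability

/-- Bound the conditional error by `1` on the bad states and by `c` elsewhere, then average. -/
theorem Code.avgError_le_of_forall_notMem {X Y : Type*} [MeasurableSpace Y] {T M : ℕ}
    (C : Code X Y T M) {ν : Measure ℕ} [IsProbabilityMeasure ν] {W : X → Measure Y}
    [∀ x, IsProbabilityMeasure (W x)] (B : Set (Fin T → ℕ)) {c : ℝ} (hc : 0 ≤ c)
    (h : ∀ s, s ∉ B → ∀ m, (Measure.pi fun ℓ => W (idcOutput (C.enc m) s ℓ)).real
      {y | C.dec ⟨_, y⟩ ≠ some m} ≤ c) :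
    C.avgError ν W ≤ ENNReal.ofReal ((Measure.pi fun _ : Fin T => ν).real B + c) := by
  have hone (m : Fin M) : channelLaw ν W (C.enc m) {y | C.dec y ≠ some m} ≤
      ENNReal.ofReal ((Measure.pi fun _ : Fin T => ν).real B + c) := by
    rw [← ofReal_measureReal (measure_ne_top _ _)]
    refine ENNReal.ofReal_le_ofReal ?_
    have hmeas : MeasurableSet {y | C.dec y ≠ some m} := (C.measurableSet_dec m).compl
    rw [channelLaw_real_apply ν W (C.enc m) hmeas]
    have hB : MeasurableSet B := .of_discrete
    have hind : Integrable (B.indicator fun _ => (1 : ℝ)) (Measure.pi fun _ : Fin T => ν) :=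
      (integrable_const 1).indicator hB
    calc _ ≤ ∫ s, (B.indicator (fun _ => (1 : ℝ)) s + c) ∂Measure.pi fun _ : Fin T => ν := by
          refine integral_mono ?_ (hind.add (integrable_const c)) fun s => ?_
          · refine Integrable.of_bound (Measurable.of_discrete).aestronglyMeasurable 1
              (.of_forall fun s => ?_)
            rw [Real.norm_of_nonneg measureReal_nonneg]
            exact measureReal_le_one
          · by_cases hs : s ∈ B
            · simp only [Set.indicator_of_mem hs]
              exact measureReal_le_one.trans (by linarith)
            · simp only [Set.indicator_of_notMem hs, zero_add]
              exact h s hs m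
      _ = _ := by
          rw [integral_add hind (integrable_const c), integral_indicator hB]
          simp
  refine ENNReal.div_le_of_le_mul ?_
  refine (Finset.sum_le_sum fun m _ => hone m).trans_eq ?_
  simp [mul_comm]

/-- Chebyshev at each of the `M + 1` block boundaries, and a union bound. -/
theorem measureReal_exists_drift_le {ν : Measure ℕ} [IsProbabilityMeasure ν]
    (hν : MemLp (fun n : ℕ => (n : ℝ)) 2 ν) (M K : ℕ) {d : ℝ} (hd : 0 < d) :
    (Measure.pi fun _ : Fin (M * K) => ν).real {s | ∃ n ≤ M,
        d ≤ |(partialLength s (n * K) : ℝ) - (n * K : ℕ) * ∫ k : ℕ, (k : ℝ) ∂ν|} ≤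
      (M + 1) * ((M * K : ℕ) * variance (fun k : ℕ => (k : ℝ)) ν / d ^ 2) := by
  have hsub : {s : Fin (M * K) → ℕ | ∃ n ≤ M,
      d ≤ |(partialLength s (n * K) : ℝ) - (n * K : ℕ) * ∫ k : ℕ, (k : ℝ) ∂ν|} =
      ⋃ n ∈ Finset.range (M + 1), {s |
        d ≤ |(partialLength s (n * K) : ℝ) - (n * K : ℕ) * ∫ k : ℕ, (k : ℝ) ∂ν|} := by
    ext s
    simp
  rw [hsub]
  refine (measureReal_biUnion_finset_le _ _).trans ((Finset.sum_le_sum fun n hn =>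
    measureReal_partialLength_le hν
      (Nat.mul_le_mul_right K (Nat.lt_succ_iff.1 (Finset.mem_range.1 hn))) hd).trans_eq ?_)
  simp

/-- Without drift of size `d`, the windows only receive copies of their own blocks. -/
theorem partialLength_le_and_le_of_drift_lt {M K w : ℕ} {μ d : ℝ} (hμ : 0 ≤ μ) (hd : 0 ≤ d)
    (hw : w + 2 * d + 1 ≤ K * μ) {s : Fin (M * K) → ℕ}
    (hs : ∀ n ≤ M, |(partialLength s (n * K) : ℝ) - (n * K : ℕ) * μ| < d) (m : Fin M) :
    partialLength s (m * K) ≤ ⌈(m * K : ℕ) * μ + d⌉₊ ∧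
      ⌈(m * K : ℕ) * μ + d⌉₊ + w ≤ partialLength s ((m + 1) * K) := by
  have h1 := abs_lt.1 (hs m m.isLt.le)
  have h2 := abs_lt.1 (hs (m + 1) m.isLt)
  have h3 := Nat.le_ceil (((m : ℕ) * K : ℕ) * μ + d)
  have h4 := Nat.ceil_lt_add_one (a := ((m : ℕ) * K : ℕ) * μ + d) (by positivity)
  constructor
  · have : (partialLength s (m * K) : ℝ) ≤ ⌈((m : ℕ) * K : ℕ) * μ + d⌉₊ := by linarith
    exact_mod_cast this
  -- In `w + 2d + 1`, one `d` is the window's offset, the other the drift of the right boundary, and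
  -- `1` covers the ceiling.
  · have : (⌈((m : ℕ) * K : ℕ) * μ + d⌉₊ : ℝ) + w ≤ partialLength s ((m + 1) * K) := by
      have e : (((m + 1 : ℕ) * K : ℕ) : ℝ) * μ = ((m : ℕ) * K : ℕ) * μ + K * μ := by
        push_cast
        ring
      linarith [h2.1]
    exact_mod_cast this

/-- At `δ = 0` the inequality is strict, so continuity keeps it for small `δ > 0`. The factors `(1 -
δ)²` and `1 - 3δ` are the losses from threshold and window; the `δ²` on the left is the exponent
that survives the union bound. -/
theorem exists_back_off {ρ : ℝ} (hρ : 1 < ρ) :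
    ∃ δ : ℝ, 0 < δ ∧ δ < 1 / 3 ∧ 1 + δ ^ 2 ≤ (1 - δ) ^ 2 * ((1 - 3 * δ) * ρ) := by
  have hcont : Continuous fun δ : ℝ => (1 - δ) ^ 2 * ((1 - 3 * δ) * ρ) - (1 + δ ^ 2) := by
    fun_prop
  have h0 : ∀ᶠ δ in nhdsWithin (0 : ℝ) (Set.Ioi 0),
      0 < (1 - δ) ^ 2 * ((1 - 3 * δ) * ρ) - (1 + δ ^ 2) :=
    (hcont.tendsto 0).mono_left nhdsWithin_le_nhds |>.eventually_const_lt (by simpa using hρ)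
  have h1 : ∀ᶠ δ in nhdsWithin (0 : ℝ) (Set.Ioi 0), δ < 1 / 3 :=
    nhdsWithin_le_nhds (eventually_lt_nhds (by norm_num))
  obtain ⟨δ, hδ0, hδ1, hδ⟩ := (h0.and (h1.and self_mem_nhdsWithin)).exists
  exact ⟨δ, hδ, hδ1, by linarith⟩

/-- For a fixed energy, long pulses of small amplitude make the effect of the drift negligible. -/
theorem exists_code_of_energy {ν : Measure ℕ} [IsProbabilityMeasure ν]
    (hν : MemLp (fun n : ℕ => (n : ℝ)) 2 ν) {μ : ℝ} (hμ : ∫ n : ℕ, (n : ℝ) ∂ν = μ) (hμ0 : 0 < μ)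
    {η : ℝ} (hη : 0 < η) (M : ℕ) {P δ ε : ℝ} (hP : 0 < P) (hδ0 : 0 < δ) (hδ1 : δ < 1 / 3)
    (hε : 0 < ε) :
    ∃ (T : ℕ) (C : Code ℝ ℝ T M), C.IsGood ν (gaussianChannel η) (fun x => x ^ 2) P
      (ε + (Real.exp (-(δ ^ 2 * ((1 - 3 * δ) * μ * P / (2 * η ^ 2)))) +
        M * Real.exp (-((1 - δ) ^ 2 * ((1 - 3 * δ) * μ * P / (2 * η ^ 2)))))) := by
  set V := variance (fun k : ℕ => (k : ℝ)) ν with hV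
  have hV0 : 0 ≤ V := variance_nonneg _ _
  -- The bound `Kδμ ≥ 2` absorbs the two roundings in `hwle`. The last bound brings the Chebyshev
  -- estimate `(M + 1)MV / (K(δμ)²)` below `ε`.
  obtain ⟨K, hK1, hK2, hK3⟩ := ((Filter.eventually_gt_atTop 0).and
    ((tendsto_natCast_atTop_atTop.eventually_ge_atTop (2 / (δ * μ))).and
    (tendsto_natCast_atTop_atTop.eventually_ge_atTop
      ((M + 1) * (M * V) / (δ * μ) ^ 2 / ε)))).exists
  have hK : (0 : ℝ) < K := by exact_mod_cast hK1
  have hδμ : 0 < δ * μ := by positivity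
  rw [div_le_iff₀ hδμ] at hK2
  rw [div_le_iff₀ hε, div_le_iff₀ (by positivity)] at hK3
  set d := K * (δ * μ) with hd
  have hd0 : 0 < d := by positivity
  set A := Real.sqrt (P / K) with hA
  have hA2 : A ^ 2 = P / K := Real.sq_sqrt (by positivity)
  set w := ⌈(1 - 3 * δ) * (K * μ)⌉₊ with hw
  have hpos : 0 < (1 - 3 * δ) * (K * μ) := mul_pos (by linarith) (by positivity)
  have hw0 : 0 < w := Nat.ceil_pos.2 hpos
  have hwle : (w : ℝ) + 2 * d + 1 ≤ K * μ := by
    have := Nat.ceil_lt_add_one hpos.le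
    rw [← hw] at this
    linarith
  have hwA : (1 - 3 * δ) * μ * P / (2 * η ^ 2) ≤ w * A ^ 2 / (2 * η ^ 2) := by
    refine div_le_div_of_nonneg_right ?_ (by positivity)
    calc (1 - 3 * δ) * μ * P = (1 - 3 * δ) * (K * μ) * A ^ 2 := by
          rw [hA2]
          field_simp
      _ ≤ w * A ^ 2 := mul_le_mul_of_nonneg_right (Nat.le_ceil _) (sq_nonneg A)
  set a : Fin M → ℕ := fun m => ⌈(m * K : ℕ) * μ + d⌉₊ with ha
  refine ⟨M * K, pulseCode M K A a w ((1 - δ) * (w * A)), fun m => ?_, ?_⟩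
  · refine ((sum_pulse_sq A m).trans ?_).le
    rw [hA2]
    field_simp
  · refine (Code.avgError_le_of_forall_notMem _ {s | ∃ n ≤ M,
        d ≤ |(partialLength s (n * K) : ℝ) - (n * K : ℕ) * ∫ k : ℕ, (k : ℝ) ∂ν|}
      (by positivity) fun s hs m => measureReal_pulseCode_ne_le (Real.sqrt_nonneg _) hη hδ0.le
        (by linarith) hw0 a (fun m' => ?_) m).trans
      (ENNReal.ofReal_le_ofReal (add_le_add ?_ (add_le_add ?_ ?_)))
    · simp only [Set.mem_ofPred_eq, not_exists, not_and, not_le, hμ] at hs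
      exact partialLength_le_and_le_of_drift_lt hμ0.le hd0.le hwle hs m'
    · refine (measureReal_exists_drift_le hν M K hd0).trans ?_
      rw [← mul_div_assoc, div_le_iff₀ (by positivity), hd]
      push_cast
      calc ((M : ℝ) + 1) * (M * K * V) = (M + 1) * (M * V) * K := by ring
        _ ≤ K * ε * (δ * μ) ^ 2 * K := mul_le_mul_of_nonneg_right hK3 hK.le
        _ = ε * (K * (δ * μ)) ^ 2 := by ring
    · rw [Real.exp_le_exp, neg_le_neg_iff, mul_div_assoc (_ ^ 2) (_ * _ ^ 2)]
      exact mul_le_mul_of_nonneg_left hwA (sq_nonneg δ)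
    · refine mul_le_mul_of_nonneg_left ?_ (Nat.cast_nonneg M)
      rw [Real.exp_le_exp, neg_le_neg_iff, mul_div_assoc (_ ^ 2) (_ * _ ^ 2)]
      exact mul_le_mul_of_nonneg_left hwA (sq_nonneg _)

theorem isAchievable_of_lt {ν : Measure ℕ} [IsProbabilityMeasure ν]
    (hν : MemLp (fun n : ℕ => (n : ℝ)) 2 ν) {μ : ℝ} (hμ : ∫ n : ℕ, (n : ℝ) ∂ν = μ)
    {η : ℝ} (hη : 0 < η) {R : ℝ≥0} (hR0 : 0 < R) (hR : (R : ℝ) < μ / (2 * η ^ 2 * Real.log 2)) :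
    IsAchievable ν (gaussianChannel η) (fun x => x ^ 2) R := by
  have hlog2 : 0 < Real.log 2 := Real.log_pos one_lt_two
  have hR0' : (0 : ℝ) < R := by exact_mod_cast hR0
  have hη2 : 0 < 2 * η ^ 2 * Real.log 2 := by positivity
  have hμ0 : 0 < μ := by
    rw [lt_div_iff₀ hη2] at hR
    exact lt_trans (by positivity) hR
  obtain ⟨δ, hδ0, hδ1, hδ⟩ := exists_back_off ((one_lt_div hR0').2 hR)
  set ρ := μ / (2 * η ^ 2 * Real.log 2) / R with hρ
  -- This makes the miss exponent at least `δ² log M`.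
  have hδ' : 1 ≤ (1 - 3 * δ) * ρ := by
    have h1 : 0 ≤ (1 - 3 * δ) * ρ := mul_nonneg (by linarith) (by positivity)
    have h2 : (1 - δ) ^ 2 ≤ 1 := pow_le_one₀ (by linarith) (by linarith)
    nlinarith [mul_le_mul_of_nonneg_right h2 h1, sq_nonneg δ]
  intro ε hε
  have hlim : Filter.Tendsto (fun M : ℕ => Real.exp (-(δ ^ 2 * Real.log M))) Filter.atTop
      (nhds 0) :=
    Real.tendsto_exp_neg_atTop_nhds_zero.comp ((Real.tendsto_log_atTop.comp
      tendsto_natCast_atTop_atTop).const_mul_atTop (by positivity))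
  obtain ⟨M₀, hM₀⟩ := ((Filter.eventually_ge_atTop 2).and
    (hlim.eventually_lt_const (show 0 < ε / 4 by positivity))).exists_forall_of_atTop
  refine ⟨M₀, fun M hM => ?_⟩
  obtain ⟨hM2, hMε⟩ := hM₀ M hM
  have hM2' : (2 : ℝ) ≤ M := by exact_mod_cast hM2
  have hMpos : (0 : ℝ) < M := by linarith
  have hlogM : 0 < Real.log M := Real.log_pos (by linarith)
  -- This energy gives rate exactly `R` and makes the signal-to-noise exponent `(1 - 3δ)ρ log M`.
  set P := Real.log M / (R * Real.log 2) with hP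
  have hP0 : 0 < P := by positivity
  obtain ⟨T, C, hcost, herr⟩ := exists_code_of_energy hν hμ hμ0 hη M hP0 hδ0 hδ1
    (show 0 < ε / 2 by positivity)
  have hq : (1 - 3 * δ) * μ * P / (2 * η ^ 2) = (1 - 3 * δ) * ρ * Real.log M := by
    rw [hP, hρ]
    field_simp
  rw [hq] at herr
  refine ⟨T, P, C, hP0, ⟨hcost, herr.trans (ENNReal.ofReal_le_ofReal ?_)⟩, ?_⟩
  · have h1 : Real.exp (-(δ ^ 2 * ((1 - 3 * δ) * ρ * Real.log M))) ≤
        Real.exp (-(δ ^ 2 * Real.log M)) := by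
      rw [Real.exp_le_exp, neg_le_neg_iff]
      exact mul_le_mul_of_nonneg_left (le_mul_of_one_le_left hlogM.le hδ') (sq_nonneg δ)
    have h2 : M * Real.exp (-((1 - δ) ^ 2 * ((1 - 3 * δ) * ρ * Real.log M))) ≤
        Real.exp (-(δ ^ 2 * Real.log M)) := by
      -- With `M` written as `exp (log M)`, the back-off inequality leaves an exponent of at most
      -- `-δ² log M`.
      nth_rewrite 1 [← Real.exp_log hMpos]
      rw [← Real.exp_add, Real.exp_le_exp]
      nlinarith [mul_le_mul_of_nonneg_right hδ hlogM.le]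
    linarith
  · rw [hP, Real.logb]
    refine le_of_eq ?_
    field_simp

end Achievability

end SyncChannel

theorem theorem1 (ν : Measure ℕ) [IsProbabilityMeasure ν] (μ σ η : ℝ)
    (hν : MemLp (fun n : ℕ => (n : ℝ)) 2 ν)
    (hμ : ∫ n : ℕ, (n : ℝ) ∂ν = μ)
    (hσ : variance (fun n : ℕ => (n : ℝ)) ν = σ ^ 2)
    (hη : 0 < η) :
    SyncChannel.gaussianSyncCapacity ν η =
      ENNReal.ofReal (μ / (2 * η ^ 2 * Real.log 2)) := by
  refine le_antisymm (iSup₂_le fun R hR => ?_) (le_of_forall_lt fun c hc => ?_)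
  · rw [← ENNReal.ofReal_coe_nnreal]
    exact ENNReal.ofReal_le_ofReal (hμ ▸ hR.le (hν.integrable one_le_two) hη)
  -- For `μ = 0` no such `c` exists, so only positive means reach this point.
  · obtain ⟨R, hcR, hR⟩ := ENNReal.lt_iff_exists_nnreal_btwn.1 hc
    have hR0 : 0 < R := by exact ENNReal.coe_pos.1 (bot_le.trans_lt hcR)
    rw [← ENNReal.ofReal_coe_nnreal, ENNReal.ofReal_lt_ofReal_iff_of_nonneg R.coe_nonneg] at hR
    exact hcR.trans_le (le_iSup₂_of_le R (SyncChannel.isAchievable_of_lt hν hμ hη hR0 hR) le_rfl)
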